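/- Let $1\le k\le n$, let $M_n$ be the algebra of complex $n\times n$ matrices, and let $A=\mathrm{Lin}(M_n,M_n)^{\mathrm{her}}$ be the real algebra (under composition) of $\mathbb C$-linear maps $T:M_n\to M_n$ with $T(X^*)=T(X)^*$ for all $X$. Equip $A$ with the real inner product $\langle R,S\rangle=\mathrm{Tr}(R^*S)$, where $R^*$ is the adjoint of $R$ with respect to $\langle X,Y\rangle=\mathrm{Tr}(X^*Y)$ on $M_n$, and for $C\subseteq A$ put $C^\circ=\{v\in A:\langle v,x\rangle\ge 0\ \text{for all } x\in C\}$. A linear map $S:M_n\to M_n$ is called $k$-positive if $\mathrm{Id}_{M_k}\otimes S$ maps positive semidefinite matrices in $M_k\otimes M_n$ to positive semidefinite matrices; $k$-superpositive if $S(X)=\sum_{i=1}^p L_i^*XL_i$ for finitely many matrices $L_i\in M_n$ of rank at most $k$; and $k$-entanglement breaking if it is $k$-positive and $(\mathrm{Id}_{M_k}\otimes S)(X)$ is separable for every positive semidefinite $X\in M_k\otimes M_n$, where separable means belonging to the closed convex hull of $\{P\otimes Q: P\in M_k,\ Q\in M_n \text{ positive semidefinite}\}$. Let $\mathcal P_k,\mathcal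 S_k,\mathcal{EB}_k\subseteq A$ be the respective sets of maps. Theorem 4.3. Let $C$ be any of the cones $\mathcal P_k$, $\mathcal S_k$, $\mathcal{EB}_k$, $\mathcal{EB}_k^\circ$, and let $T_0\in C$ be idempotent, $T_0\circ T_0=T_0$. Then for every $S\in A$ with $S\circ T_0=T_0\circ S=S$ the following are equivalent: (i) $\exp_{T_0}(tS):=T_0+\sum_{m=1}^\infty \frac{t^m S^{\circ m}}{m!}\in C$ for all $t\ge 0$; (ii) $S$ is $T_0$-conditionally positive on $C^\circ$, that is, $\langle v,S\rangle\ge 0$ for every $v\in C^\circ$ with $\langle v,T_0\rangle=0$. -/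

import Mathlib

open scoped ComplexOrder Kronecker Nat

noncomputable section

namespace QCone

/-- The complex matrix algebra `M_n`. -/
abbrev Mat (n : ℕ) : Type := Matrix (Fin n) (Fin n) ℂ

/-- `Lin(M_n, M_n)` as a topological algebra under composition. Since `M_n` is finite dimensional,
every linear map is continuous, and the topology is the unique Hausdorff vector space topology. -/
abbrev Lin (n : ℕ) : Type := Mat n →L[ℂ] Mat n

/-- The real algebra of hermiticity preserving maps `T`, i.e. `T (X*) = (T X)*` for all `X`,
with composition as multiplication. -/
def hermAlg (n : ℕ) : Subalgebra ℝ (Lin n) where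
  carrier := {T | ∀ X : Mat n, T X.conjTranspose = (T X).conjTranspose}
  mul_mem' := by
    intro S T hS hT X
    simp only [Set.mem_ofPred_eq] at hS hT
    simp [hS, hT]
  add_mem' := by
    intro S T hS hT X
    simp only [Set.mem_ofPred_eq] at hS hT
    simp [hS, hT]
  algebraMap_mem' := by
    intro r X
    rw [Algebra.algebraMap_eq_smul_one]
    ext i j
    simp [Matrix.conjTranspose_apply]

abbrev HermMap (n : ℕ) : Type := hermAlg n

/-- The map underlying a hermiticity preserving map, as a plain linear map. -/
def HermMap.lin {n : ℕ} (T : HermMap n) : Mat n →ₗ[ℂ] Mat n :=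
  ((T : Lin n) : Mat n →ₗ[ℂ] Mat n)

theorem HermMap.lin_conjTranspose {n : ℕ} (T : HermMap n) (X : Mat n) :
    T.lin X.conjTranspose = (T.lin X).conjTranspose := T.2 X

/-! The Hilbert-Schmidt pairing `⟨R, S⟩ = Tr (R* S)`, where `R*` is the adjoint of `R` with respect
to the Hilbert-Schmidt inner product `⟨A, B⟩ = Tr (A* B)` on `M_n`. -/

/-- The adjoint of a linear map with respect to `⟨A, B⟩ = Tr (A* B)`; its defining property is
`trace_hsAdjoint`. -/
def hsAdjoint {n : ℕ} (R : Mat n →ₗ[ℂ] Mat n) : Mat n →ₗ[ℂ] Mat n where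
  toFun A := Matrix.of fun i j => ((R (Matrix.single i j 1)).conjTranspose * A).trace
  map_add' A B := by ext i j; simp [mul_add]
  map_smul' c A := by ext i j; simp

theorem trace_hsAdjoint {n : ℕ} (R : Mat n →ₗ[ℂ] Mat n) (A B : Mat n) :
    ((hsAdjoint R A).conjTranspose * B).trace = (A.conjTranspose * R B).trace := by
  have key : ∀ i j : Fin n, ((hsAdjoint R A).conjTranspose * Matrix.single i j 1).trace
      = (A.conjTranspose * R (Matrix.single i j 1)).trace := by
    intro i j
    rw [Matrix.trace_mul_single]
    simp only [hsAdjoint, LinearMap.coe_mk, AddHom.coe_mk, Matrix.conjTranspose_apply,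
      Matrix.of_apply, MulOpposite.op_one, one_smul]
    rw [← Matrix.trace_conjTranspose, Matrix.conjTranspose_mul, Matrix.conjTranspose_conjTranspose]
  have h : ((Matrix.traceLinearMap (Fin n) ℂ ℂ).comp
        (LinearMap.mulLeft ℂ (hsAdjoint R A).conjTranspose))
      = (Matrix.traceLinearMap (Fin n) ℂ ℂ).comp
        ((LinearMap.mulLeft ℂ A.conjTranspose).comp R) := by
    apply Matrix.ext_linearMap
    intro i j
    ext
    simpa using key i j
  simpa using LinearMap.congr_fun h B

/-- The complex number `Tr (R* S)`. -/
def hsInner {n : ℕ} (R S : Mat n →ₗ[ℂ] Mat n) : ℂ :=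
  LinearMap.trace ℂ (Mat n) (hsAdjoint R ∘ₗ S)

theorem hsInner_eq_sum {n : ℕ} (R S : Mat n →ₗ[ℂ] Mat n) :
    hsInner R S = ∑ i, ∑ j,
      ((R (Matrix.single i j 1)).conjTranspose * S (Matrix.single i j 1)).trace := by
  rw [hsInner, LinearMap.trace_eq_matrix_trace ℂ (Matrix.stdBasis ℂ (Fin n) (Fin n)),
    Matrix.trace, Fintype.sum_prod_type]
  refine Finset.sum_congr rfl fun i _ => Finset.sum_congr rfl fun j _ => ?_
  rw [Matrix.diag_apply, LinearMap.toMatrix_apply, Matrix.stdBasis_eq_single]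
  rfl

/-- On hermiticity preserving maps, `Tr (R* S)` is a real number. -/
theorem hsInner_im {n : ℕ} (R S : HermMap n) : (hsInner R.lin S.lin).im = 0 := by
  rw [← Complex.conj_eq_iff_im, hsInner_eq_sum]
  simp only [map_sum]
  rw [Finset.sum_comm]
  refine Finset.sum_congr rfl fun i _ => Finset.sum_congr rfl fun j _ => ?_
  have h : (Matrix.single j i (1 : ℂ)) = (Matrix.single i j (1 : ℂ)).conjTranspose := by simp
  rw [h, R.lin_conjTranspose, S.lin_conjTranspose, starRingEnd_apply,
    ← Matrix.trace_conjTranspose, Matrix.conjTranspose_mul, Matrix.conjTranspose_conjTranspose,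
    Matrix.trace_mul_comm]
  simp

/-- The real inner product `⟨R, S⟩ = Tr (R* S)` on hermiticity preserving maps. -/
def pairing {n : ℕ} (R S : HermMap n) : ℝ := (hsInner R.lin S.lin).re

/-- The dual cone `C°` in the real algebra of hermiticity preserving maps. -/
def dualCone {n : ℕ} (C : Set (HermMap n)) : Set (HermMap n) :=
  {v | ∀ x ∈ C, 0 ≤ pairing v x}

/-- `Id_k ⊗ S` on `M_k ⊗ M_n`, realized as matrices with index set `Fin k × Fin n`:
`S` is applied to each of the `n × n` blocks. -/
def ampliation {n : ℕ} (k : ℕ) (S : Mat n →ₗ[ℂ] Mat n) :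
    Matrix (Fin k × Fin n) (Fin k × Fin n) ℂ →ₗ[ℂ] Matrix (Fin k × Fin n) (Fin k × Fin n) ℂ where
  toFun X := Matrix.of fun p q => S (Matrix.of fun a b => X (p.1, a) (q.1, b)) p.2 q.2
  map_add' X Y := by
    ext p q
    simp only [Matrix.of_apply, Matrix.add_apply]
    rw [← Matrix.add_apply, ← map_add]
    rfl
  map_smul' c X := by
    ext p q
    simp only [Matrix.of_apply, Matrix.smul_apply, RingHom.id_apply]
    rw [← Matrix.smul_apply, ← map_smul]
    rfl

theorem ampliation_kronecker {n : ℕ} (k : ℕ) (S : Mat n →ₗ[ℂ] Mat n) (A : Mat k) (B : Mat n) :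
    ampliation k S (A ⊗ₖ B) = A ⊗ₖ S B := by
  ext p q
  have h : (Matrix.of fun a b => A p.1 q.1 * B a b) = A p.1 q.1 • B := by
    ext a b
    simp
  simp only [ampliation, LinearMap.coe_mk, AddHom.coe_mk, Matrix.of_apply,
    Matrix.kroneckerMap_apply]
  rw [h, map_smul, Matrix.smul_apply, smul_eq_mul]

/-- `k`-positive maps. -/
def IsKPositive {n : ℕ} (k : ℕ) (S : Mat n →ₗ[ℂ] Mat n) : Prop :=
  ∀ X : Matrix (Fin k × Fin n) (Fin k × Fin n) ℂ, X.PosSemidef → (ampliation k S X).PosSemidef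

/-- `k`-superpositive maps: those with a Kraus representation by matrices of rank at most `k`. -/
def IsKSuperpositive {n : ℕ} (k : ℕ) (S : Mat n →ₗ[ℂ] Mat n) : Prop :=
  ∃ (p : ℕ) (L : Fin p → Mat n), (∀ i, (L i).rank ≤ k) ∧
    ∀ X : Mat n, S X = ∑ i, (L i).conjTranspose * X * L i

/-- Separable elements of `M_k ⊗ M_n`: the closed convex hull of the tensor products `A ⊗ B`
of positive semidefinite matrices. -/
def separable (k n : ℕ) : Set (Matrix (Fin k × Fin n) (Fin k × Fin n) ℂ) :=
  closure (convexHull ℝ {X | ∃ (A : Mat k) (B : Mat n), A.PosSemidef ∧ B.PosSemidef ∧ X = A ⊗ₖ B})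

/-- `k`-entanglement breaking maps. -/
def IsKEntanglementBreaking {n : ℕ} (k : ℕ) (S : Mat n →ₗ[ℂ] Mat n) : Prop :=
  IsKPositive k S ∧ ∀ X : Matrix (Fin k × Fin n) (Fin k × Fin n) ℂ, X.PosSemidef →
    ampliation k S X ∈ separable k n

/-- The cone `P_k`. -/
def coneP (n k : ℕ) : Set (HermMap n) := {S | IsKPositive k S.lin}

/-- The cone `S_k`. -/
def coneS (n k : ℕ) : Set (HermMap n) := {S | IsKSuperpositive k S.lin}

/-- The cone `EB_k`. -/
def coneEB (n k : ℕ) : Set (HermMap n) := {S | IsKEntanglementBreaking k S.lin}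

/-- `exp_{T₀}(S) = T₀ + ∑_{m ≥ 1} S^m / m!`. The series converges, see `summable_expFrom`. -/
def expFrom {n : ℕ} (T₀ S : HermMap n) : HermMap n :=
  T₀ + ∑' m : ℕ, (((m + 1)! : ℝ)⁻¹) • S ^ (m + 1)

theorem summable_exp_aux {B : Type*} [NormedRing B] [NormedAlgebra ℝ B] [FiniteDimensional ℝ B]
    (A : Subalgebra ℝ B) (S : A) : Summable fun m : ℕ => (((m + 1)! : ℝ)⁻¹) • S ^ (m + 1) := by
  have : CompleteSpace A := FiniteDimensional.complete ℝ _
  exact (summable_nat_add_iff (f := fun m : ℕ => ((m ! : ℝ)⁻¹) • S ^ m) 1).2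
    (NormedSpace.expSeries_summable' (𝕂 := ℝ) S)

section

open scoped Matrix.Norms.L2Operator

theorem summable_expFrom {n : ℕ} (S : HermMap n) :
    Summable fun m : ℕ => (((m + 1)! : ℝ)⁻¹) • S ^ (m + 1) := by
  have h1 : FiniteDimensional ℂ (Lin n) := inferInstance
  have : FiniteDimensional ℝ (Lin n) := FiniteDimensional.trans ℝ ℂ (Lin n)
  exact summable_exp_aux (B := Lin n) (hermAlg n) S

end

end QCone

end

/-!
The equivalence holds for every closed convex cone `C` of hermiticity preserving maps that is stable
under composition (`IsMulClosedCone`). Since `T₀ S = S`, the exponential is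
`exp_{T₀}(t S) = T₀ ∘ exp(t S)`, whose derivative at `t = 0` is `S`.

If the semigroup stays in `C`, then for `v ∈ C°` with `⟨v, T₀⟩ = 0` the function
`t ↦ ⟨v, exp_{T₀}(t S)⟩` is nonnegative and vanishes at `0`, so its derivative `⟨v, S⟩` at `0` is
nonnegative. Conversely, conditional positivity says by Hahn-Banach that `S` is in the closure of
`C + ℝ T₀`. For `c ∈ C` put `c' = T₀ c T₀ ∈ C`; then `T₀ ∘ exp(c' - l T₀)` is
`e^{-l} (T₀ + ∑ c'^m / m!)`, which is in `C`. Compressing an approximation `c - l T₀` of `S` by `T₀`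
and passing to the limit gives `exp_{T₀}(S) ∈ C`. This is `IsMulClosedCone.add_tsum_mem_iff`.

It remains to see that the four cones are of this kind, and two points need an argument.
* `S_k` is closed. It is the cone over the convex hull of the maps `X ↦ L* X L` with `rank L ≤ k` and
  `Tr (L* L) = 1`. These form a compact set, since rank is lower semicontinuous; its convex hull is
  compact by Carathéodory's theorem; and `T ↦ Tr (T 1)` is `1` on it, so the cone over it is closed.
* `EB_k°` is stable under composition. As `EB_k` contains the maps `X ↦ ⟨a, X a⟩ B` with `B`
  positive semidefinite, each `v ∈ EB_k°` has a positive adjoint `v*`. Composing with a positive map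
  on the left preserves `EB_k`, because ampliations of positive maps preserve separability.
  Hence `⟨v w, x⟩ = ⟨w, v* x⟩ ≥ 0` for `v, w ∈ EB_k°` and `x ∈ EB_k`.
-/

/-! ### Conditional positivity for multiplicative closed convex cones -/

/-- A closed convex cone, in a topological real algebra, that is stable under multiplication.
The apex `0` is not required to be a member, but it is one as soon as the cone is nonempty. -/
structure IsMulClosedCone {A : Type*} [TopologicalSpace A] [Ring A] [Module ℝ A]
    (C : Set A) : Prop where
  isClosed : IsClosed C
  add_mem : ∀ {x y : A}, x ∈ C → y ∈ C → x + y ∈ C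
  smul_mem : ∀ {r : ℝ} {x : A}, 0 ≤ r → x ∈ C → r • x ∈ C
  mul_mem : ∀ {x y : A}, x ∈ C → y ∈ C → x * y ∈ C

/-- On a finite-dimensional space, an anisotropic bilinear form represents every functional. -/
theorem exists_apply_eq_of_anisotropic {V : Type*} [AddCommGroup V] [Module ℝ V]
    [FiniteDimensional ℝ V] (B : V →ₗ[ℝ] V →ₗ[ℝ] ℝ) (hB : ∀ v, B v v = 0 → v = 0)
    (f : V →ₗ[ℝ] ℝ) : ∃ v, B v = f := by
  have hinj : Function.Injective B := by
    rw [injective_iff_map_eq_zero]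
    exact fun v hv => hB v (LinearMap.congr_fun hv v)
  exact (LinearMap.injective_iff_surjective_of_finrank_eq_finrank
    (Subspace.dual_finrank_eq (K := ℝ) (V := V)).symm).1 hinj f

namespace IsMulClosedCone

section Bipolar

variable {A : Type*} [NormedRing A] [NormedAlgebra ℝ A]

/-- One instance of the bipolar theorem: the functionals that are nonnegative on `C` and vanish
at `e` detect the closure of `C + ℝ e`. -/
theorem mem_closure_of_forall_nonneg {C : Set A} (hC : IsMulClosedCone C) {e x : A} (he : e ∈ C)
    (h : ∀ f : A →L[ℝ] ℝ, (∀ c ∈ C, 0 ≤ f c) → f e = 0 → 0 ≤ f x) :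
    x ∈ closure {y | ∃ c ∈ C, ∃ l : ℝ, y = c - l • e} := by
  by_contra hx
  set K : Set A := {y | ∃ c ∈ C, ∃ l : ℝ, y = c - l • e}
  have hK : Convex ℝ K := by
    rintro _ ⟨c, hc, l, rfl⟩ _ ⟨d, hd, m, rfl⟩ a b ha hb -
    refine ⟨a • c + b • d, hC.add_mem (hC.smul_mem ha hc) (hC.smul_mem hb hd), a * l + b * m, ?_⟩
    module
  obtain ⟨f, u, hfx, hfK⟩ := geometric_hahn_banach_point_closed hK.closure isClosed_closure hx
  have hmem : ∀ c ∈ C, ∀ l r : ℝ, 0 ≤ r → u < r * f c - l * f e := by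
    intro c hc l r hr
    simpa using hfK _ (subset_closure ⟨r • c, hC.smul_mem hr hc, l, rfl⟩)
  have hu : u < 0 := by simpa using hmem e he 0 0 le_rfl
  -- A functional bounded below on a cone is nonnegative on it.
  have hpos : ∀ c ∈ C, 0 ≤ f c := by
    intro c hc
    by_contra! hneg
    have := hmem c hc 0 (u / f c) (div_nonneg_of_nonpos hu.le hneg.le)
    rw [div_mul_cancel₀ _ hneg.ne] at this
    simp at this
  have hfe : f e = 0 := by
    by_contra hne
    have := hmem e he (-(u / f e)) 0 le_rfl
    rw [neg_mul, div_mul_cancel₀ _ hne] at this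
    simp at this
  linarith [h f hpos hfe]

end Bipolar

variable {A : Type*} [NormedRing A] [NormedAlgebra ℝ A] [CompleteSpace A]

/-- On the corner cut out by the idempotent `e`, the exponential of a translate `c - l • e` of an
element of the cone is a positive multiple of that of `c`. -/
theorem idempotent_mul_exp_mem {C : Set A} (hC : IsMulClosedCone C) {e c : A} (he : e ∈ C)
    (hidem : IsIdempotentElem e) (hc : c ∈ C) (hec : e * c = c) (hce : c * e = c) (l : ℝ) :
    e * NormedSpace.exp (c - l • e) ∈ C := by
  have hpow : ∀ m : ℕ, e * ((-l) • e) ^ m = (-l) ^ m • e := by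
    intro m
    induction m with
    | zero => simp
    | succ m ih => rw [pow_succ, ← mul_assoc, ih, smul_mul_smul_comm, hidem.eq, pow_succ]
  have hexp : e * NormedSpace.exp ((-l) • e) = Real.exp (-l) • e := by
    have h1 := (NormedSpace.exp_series_hasSum_exp' (𝕂 := ℝ) ((-l) • e)).mul_left e
    have h2 := (NormedSpace.exp_series_hasSum_exp' (𝕂 := ℝ) (-l)).smul_const e
    rw [← Real.exp_eq_exp_ℝ] at h2
    simp only [smul_assoc] at h2
    simp only [mul_smul_comm, hpow] at h1
    exact h1.unique h2
  have hcomm : Commute ((-l) • e) c := by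
    rw [Commute, SemiconjBy, smul_mul_assoc, mul_smul_comm, hec, hce]
  let _ : NormedAlgebra ℚ A := NormedAlgebra.restrictScalars ℚ ℝ A
  rw [sub_eq_add_neg, ← neg_smul, add_comm, NormedSpace.exp_add_of_commute hcomm, ← mul_assoc,
    hexp, smul_mul_assoc]
  refine hC.smul_mem (Real.exp_pos _).le ?_
  have hterm : ∀ m : ℕ, e * c ^ m ∈ C := by
    intro m
    induction m with
    | zero => simpa using he
    | succ m ih => rw [pow_succ, ← mul_assoc]; exact hC.mul_mem ih hc
  refine hC.isClosed.mem_of_tendsto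
    ((NormedSpace.exp_series_hasSum_exp' (𝕂 := ℝ) c).mul_left e) (.of_forall fun s => ?_)
  refine Finset.sum_induction _ (· ∈ C) (fun _ _ => hC.add_mem) ?_ fun m _ => ?_
  · simpa using hC.smul_mem le_rfl he
  · rw [mul_smul_comm]
    exact hC.smul_mem (by positivity) (hterm m)

/-- If all functionals that are nonnegative on `C` and vanish at the idempotent `e ∈ C` are
nonnegative at `S`, then `S` generates a semigroup in `C`. The element `S` is a limit of differences
`c - l • e`, and compressing by `e` brings these to the corner `e A e`. -/
theorem idempotent_mul_exp_mem_of_forall_nonneg {C : Set A} (hC : IsMulClosedCone C) {e S : A}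
    (he : e ∈ C) (hidem : IsIdempotentElem e) (heS : e * S = S) (hSe : S * e = S)
    (h : ∀ f : A →L[ℝ] ℝ, (∀ c ∈ C, 0 ≤ f c) → f e = 0 → 0 ≤ f S) :
    e * NormedSpace.exp S ∈ C := by
  have hmem := hC.mem_closure_of_forall_nonneg he h
  have hcont : Continuous fun y : A => e * NormedSpace.exp (e * y * e) := by
    let _ : NormedAlgebra ℚ A := NormedAlgebra.restrictScalars ℚ ℝ A
    have := NormedSpace.exp_continuous (𝔸 := A)
    fun_prop
  have : e * NormedSpace.exp (e * S * e) ∈ closure C := by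
    refine map_mem_closure (f := fun y : A => e * NormedSpace.exp (e * y * e)) hcont hmem ?_
    rintro _ ⟨c, hc, l, rfl⟩
    have h1 : e * (c - l • e) * e = e * c * e - l • e := by
      rw [mul_sub, sub_mul, mul_smul_comm, smul_mul_assoc, hidem.eq, hidem.eq]
    simp only [h1]
    refine hC.idempotent_mul_exp_mem he hidem (hC.mul_mem (hC.mul_mem he hc) he) ?_ ?_ l
    · rw [← mul_assoc, ← mul_assoc, hidem.eq]
    · rw [mul_assoc, hidem.eq]
  rwa [heS, hSe, hC.isClosed.closure_eq] at this

/-- The converse direction, by differentiating the semigroup at `0`. No cone structure is used. -/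
theorem nonneg_of_forall_idempotent_mul_exp {e S : A} (heS : e * S = S)
    (f : A →L[ℝ] ℝ) (hfe : f e = 0) (h : ∀ t : ℝ, 0 ≤ t → 0 ≤ f (e * NormedSpace.exp (t • S))) :
    0 ≤ f S := by
  have hd : HasDerivAt (fun t : ℝ => f (e * NormedSpace.exp (t • S))) (f S) 0 := by
    have := (hasDerivAt_exp_smul_const (𝕂 := ℝ) S 0).const_mul e
    simp only [zero_smul, NormedSpace.exp_zero, one_mul, heS] at this
    exact f.hasFDerivAt.comp_hasDerivAt (0 : ℝ) this
  have hs := hd.tendsto_slope_zero_right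
  refine ge_of_tendsto hs ?_
  filter_upwards [self_mem_nhdsWithin] with t ht
  have ht' : (0 : ℝ) < t := ht
  simp only [zero_add, zero_smul, NormedSpace.exp_zero, mul_one, hfe, sub_zero, smul_eq_mul]
  exact mul_nonneg (inv_nonneg.2 ht'.le) (h t ht'.le)

/-- Semigroup generation is equivalent to conditional positivity, in a subalgebra of a
finite-dimensional normed algebra. The series is that of `T * exp (t • S)`. -/
theorem add_tsum_mem_iff {B : Type*} [NormedRing B] [NormedAlgebra ℝ B] [FiniteDimensional ℝ B]
    (A : Subalgebra ℝ B) (P : A →ₗ[ℝ] A →ₗ[ℝ] ℝ) (hP : ∀ v, P v v = 0 → v = 0)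
    {C : Set A} (hC : IsMulClosedCone C) {T S : A} (hT : T ∈ C)
    (hidem : IsIdempotentElem T) (hST : S * T = S) (hTS : T * S = S) :
    (∀ t : ℝ, 0 ≤ t → T + ∑' m : ℕ, (((m + 1)! : ℝ)⁻¹) • (t • S) ^ (m + 1) ∈ C) ↔
      (∀ v : A, (∀ c ∈ C, 0 ≤ P v c) → P v T = 0 → 0 ≤ P v S) := by
  have : CompleteSpace A := FiniteDimensional.complete ℝ _
  have hTS' : ∀ t : ℝ, T * (t • S) = t • S := fun t => by rw [mul_smul_comm, hTS]
  have hST' : ∀ t : ℝ, (t • S) * T = t • S := fun t => by rw [smul_mul_assoc, hST]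
  have hexp : ∀ t : ℝ, T + ∑' m : ℕ, (((m + 1)! : ℝ)⁻¹) • (t • S) ^ (m + 1) =
      T * NormedSpace.exp (t • S) := by
    intro t
    have h1 := (hasSum_nat_add_iff' 1).2
      ((NormedSpace.exp_series_hasSum_exp' (𝕂 := ℝ) (t • S)).mul_left T)
    have h2 : ∀ m : ℕ, T * ((((m + 1)! : ℝ)⁻¹) • (t • S) ^ (m + 1)) =
        (((m + 1)! : ℝ)⁻¹) • (t • S) ^ (m + 1) :=
      fun m => by rw [mul_smul_comm, pow_succ', ← mul_assoc, hTS']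
    simp only [h2, Finset.range_one, Finset.sum_singleton, pow_zero, Nat.factorial_zero,
      Nat.cast_one, inv_one, one_smul, mul_one] at h1
    rw [h1.tsum_eq, add_sub_cancel]
  simp only [hexp]
  constructor
  · intro h v hf hf0
    exact nonneg_of_forall_idempotent_mul_exp hTS (LinearMap.toContinuousLinearMap (P v)) hf0
      fun t ht => hf _ (h t ht)
  · intro h t ht
    refine hC.idempotent_mul_exp_mem_of_forall_nonneg hT hidem (hTS' t) (hST' t) fun f hf hf0 => ?_
    obtain ⟨v, hv⟩ := exists_apply_eq_of_anisotropic P hP (f : A →ₗ[ℝ] ℝ)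
    have hv' : ∀ x, f x = P v x := fun x => (LinearMap.congr_fun hv x).symm
    simp only [hv'] at hf hf0 ⊢
    rw [map_smul]
    exact mul_nonneg ht (h v hf hf0)

end IsMulClosedCone

/-! ### Closedness of cones over compact sets -/

section CompactBase

variable {V : Type*} [AddCommGroup V] [Module ℝ V] [TopologicalSpace V]

/-- By Carathéodory's theorem, the convex hull is the image of the compact set of families of
`dim V + 1` points with weights. -/
theorem IsCompact.convexHull_of_finiteDimensional [ContinuousAdd V] [ContinuousSMul ℝ V]
    [FiniteDimensional ℝ V] {s : Set V} (hs : IsCompact s) : IsCompact (convexHull ℝ s) := by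
  set N := Module.finrank ℝ V + 1
  let F : (Fin N → ℝ) × (Fin N → V) → V := fun p => ∑ i, p.1 i • p.2 i
  have hF : Continuous F := by fun_prop
  have hcomp : IsCompact (stdSimplex ℝ (Fin N) ×ˢ Set.univ.pi fun _ : Fin N => s) :=
    (isCompact_stdSimplex ℝ (Fin N)).prod (isCompact_univ_pi fun _ => hs)
  convert hcomp.image hF using 1
  refine Set.Subset.antisymm (fun x hx => ?_) ?_
  · obtain ⟨ι, _, z, w, hz, hind, hw, hw1, rfl⟩ := eq_pos_convex_span_of_mem_convexHull hx
    have hcard : Fintype.card ι ≤ Fintype.card (Fin N) := by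
      rw [Fintype.card_fin]
      exact hind.card_le_finrank_succ.trans (Nat.succ_le_succ (Submodule.finrank_le _))
    obtain ⟨e⟩ := Function.Embedding.nonempty_of_card_le hcard
    have hne : Nonempty ι := by
      by_contra hemp
      rw [not_nonempty_iff] at hemp
      simp at hw1
    obtain ⟨i₀⟩ := hne
    have hext : ∀ i, Function.extend e w 0 (e i) = w i := fun i => e.injective.extend_apply _ _ _
    have hext0 : ∀ j ∉ Set.range e, Function.extend e w 0 j = 0 := fun j hj =>
      Function.extend_apply' _ _ _ hj
    have hextz : ∀ i, Function.extend e z (fun _ => z i₀) (e i) = z i :=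
      fun i => e.injective.extend_apply _ _ _
    refine ⟨(Function.extend e w 0, Function.extend e z fun _ => z i₀), ⟨⟨fun j => ?_, ?_⟩,
      fun j _ => ?_⟩, ?_⟩
    · by_cases hj : j ∈ Set.range e
      · obtain ⟨i, rfl⟩ := hj
        exact (hw i).le.trans_eq (hext i).symm
      · exact (hext0 j hj).symm.le
    · rw [← hw1]
      exact (Fintype.sum_of_injective e e.injective _ _ hext0 fun i => (hext i).symm).symm
    · by_cases hj : j ∈ Set.range e
      · obtain ⟨i, rfl⟩ := hj
        simpa only [hextz] using hz ⟨i, rfl⟩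
      · simpa only [Function.extend_apply' _ _ _ hj] using hz ⟨i₀, rfl⟩
    · refine (Fintype.sum_of_injective e e.injective _ _ (fun j hj => ?_) fun i => ?_).symm
      · simp only [hext0 j hj, zero_smul]
      · simp only [hext, hextz]
  · rintro _ ⟨⟨w, z⟩, ⟨hw, hz⟩, rfl⟩
    exact (convex_convexHull ℝ s).sum_mem (fun i _ => hw.1 i) hw.2
      fun i _ => subset_convexHull ℝ s (hz i (Set.mem_univ i))

/-- A cone over a compact base that lies in the hyperplane `f = 1` is closed. -/
theorem IsCompact.isClosed_cone [T2Space V] [ContinuousSMul ℝ V] {K : Set V} (hK : IsCompact K)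
    {f : V →ₗ[ℝ] ℝ} (hf : Continuous f) (hfK : ∀ x ∈ K, f x = 1) :
    IsClosed {x | ∃ r : ℝ, 0 ≤ r ∧ ∃ y ∈ K, x = r • y} := by
  have : CompactSpace K := isCompact_iff_compactSpace.1 hK
  have hcl : IsClosed {p : V × K | 0 ≤ f p.1 ∧ p.1 = f p.1 • (p.2 : V)} :=
    IsClosed.inter (isClosed_le (f := fun _ : V × K => (0 : ℝ)) (g := fun p => f p.1)
        (by fun_prop) (by fun_prop))
      (isClosed_eq (f := fun p : V × K => p.1) (g := fun p => f p.1 • (p.2 : V))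
        (by fun_prop) (by fun_prop))
  convert isClosedMap_fst_of_compactSpace _ hcl using 1
  ext x
  constructor
  · rintro ⟨r, hr, y, hy, rfl⟩
    have hfy : f (r • y) = r := by rw [map_smul, hfK y hy, smul_eq_mul, mul_one]
    exact ⟨(r • y, ⟨y, hy⟩), ⟨by simpa only [hfy], by simp only [hfy]⟩, rfl⟩
  · rintro ⟨⟨x, y⟩, ⟨h0, h1⟩, rfl⟩
    exact ⟨f x, h0, y, y.2, h1⟩

end CompactBase

/-- Rank is lower semicontinuous. -/
theorem Matrix.isClosed_setOf_rank_le (n k : ℕ) :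
    IsClosed {L : Matrix (Fin n) (Fin n) ℂ | L.rank ≤ k} := by
  let F : Matrix (Fin n) (Fin n) ℂ → (Fin n → ℂ) →L[ℂ] (Fin n → ℂ) :=
    fun L => LinearMap.toContinuousLinearMap L.mulVecLin
  have hF : Continuous F := continuous_clm_apply.2 fun x =>
    continuous_id.matrix_mulVec continuous_const
  have h := ((isOpen_setOfPred_nat_le_rank (𝕜 := ℂ) (E := Fin n → ℂ) (F := Fin n → ℂ)
    (k + 1)).preimage hF).isClosed_compl
  convert h using 1
  ext L
  have : (F L : (Fin n → ℂ) →ₗ[ℂ] (Fin n → ℂ)).rank = (L.rank : Cardinal) := by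
    rw [Matrix.rank, Module.finrank_eq_rank]
    rfl
  simp only [Set.mem_compl_iff, Set.mem_preimage, Set.mem_ofPred_eq, this, Nat.cast_le]
  omega

noncomputable section

namespace QCone

/-! ### The pairing on hermiticity preserving maps -/

@[simp] theorem HermMap.lin_add {n : ℕ} (S T : HermMap n) : (S + T).lin = S.lin + T.lin := rfl

@[simp] theorem HermMap.lin_mul {n : ℕ} (S T : HermMap n) : (S * T).lin = S.lin ∘ₗ T.lin := rfl

theorem HermMap.lin_smul_apply {n : ℕ} (r : ℝ) (S : HermMap n) (X : Mat n) :
    (r • S).lin X = r • S.lin X := rfl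

theorem HermMap.ext_lin {n : ℕ} {S T : HermMap n} (h : ∀ X, S.lin X = T.lin X) : S = T :=
  Subtype.ext (ContinuousLinearMap.ext h)

/-- The hermiticity preserving map with a given underlying linear map. -/
def HermMap.ofLin {n : ℕ} (T : Mat n →ₗ[ℂ] Mat n)
    (hT : ∀ X : Mat n, T X.conjTranspose = (T X).conjTranspose) : HermMap n :=
  ⟨LinearMap.toContinuousLinearMap T, hT⟩

@[simp] theorem HermMap.lin_ofLin {n : ℕ} (T : Mat n →ₗ[ℂ] Mat n)
    (hT : ∀ X : Mat n, T X.conjTranspose = (T X).conjTranspose) : (HermMap.ofLin T hT).lin = T :=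
  rfl

theorem pairing_eq_sum {n : ℕ} (R S : HermMap n) : pairing R S = ∑ i, ∑ j,
    ((R.lin (Matrix.single i j 1)).conjTranspose * S.lin (Matrix.single i j 1)).trace.re := by
  simp [pairing, hsInner_eq_sum]

/-- The pairing as a bilinear map over `ℝ`. -/
def pairingₗ (n : ℕ) : HermMap n →ₗ[ℝ] HermMap n →ₗ[ℝ] ℝ :=
  LinearMap.mk₂ ℝ pairing
    (fun R R' S => by
      simp [pairing_eq_sum, add_mul, Finset.sum_add_distrib])
    (fun r R S => by
      simp [pairing_eq_sum, HermMap.lin_smul_apply, Finset.mul_sum])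
    (fun R S S' => by
      simp [pairing_eq_sum, mul_add, Finset.sum_add_distrib])
    (fun r R S => by
      simp [pairing_eq_sum, HermMap.lin_smul_apply, Finset.mul_sum])

theorem pairing_comm {n : ℕ} (R S : HermMap n) : pairing R S = pairing S R := by
  simp only [pairing_eq_sum]
  refine Finset.sum_congr rfl fun i _ => Finset.sum_congr rfl fun j _ => ?_
  rw [← Complex.conj_re, starRingEnd_apply, ← Matrix.trace_conjTranspose]
  simp

theorem eq_zero_of_pairing_self_eq_zero {n : ℕ} {R : HermMap n} (h : pairing R R = 0) :
    R = 0 := by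
  have hnn : ∀ i j, 0 ≤ ((R.lin (Matrix.single i j 1)).conjTranspose *
      R.lin (Matrix.single i j 1)).trace := fun i j =>
    (Matrix.posSemidef_conjTranspose_mul_self _).trace_nonneg
  have hre : ∀ i j, 0 ≤ ((R.lin (Matrix.single i j 1)).conjTranspose *
      R.lin (Matrix.single i j 1)).trace.re := fun i j => (Complex.nonneg_iff.1 (hnn i j)).1
  rw [pairing_eq_sum, Finset.sum_eq_zero_iff_of_nonneg
    fun i _ => Finset.sum_nonneg fun j _ => hre i j] at h
  have hz : R.lin = 0 := by
    refine Matrix.ext_linearMap ℂ fun i j => ?_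
    ext1
    have hij := (Finset.sum_eq_zero_iff_of_nonneg fun j _ => hre i j).1 (h i (Finset.mem_univ _)) j
      (Finset.mem_univ _)
    have h0 : ((R.lin (Matrix.single i j 1)).conjTranspose *
        R.lin (Matrix.single i j 1)).trace = 0 :=
      Complex.ext hij (Complex.nonneg_iff.1 (hnn i j)).2.symm
    simpa using Matrix.trace_conjTranspose_mul_self_eq_zero_iff.1 h0
  exact HermMap.ext_lin fun X => by rw [hz]; rfl

section Norm

open scoped Matrix.Norms.L2Operator

/-- Semigroup generation is equivalent to conditional positivity for every closed convex cone that
is stable under composition. -/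
theorem expFrom_mem_iff {n : ℕ} {C : Set (HermMap n)} (hC : IsMulClosedCone C) {T₀ S : HermMap n}
    (hT₀ : T₀ ∈ C) (hidem : IsIdempotentElem T₀) (hST : S * T₀ = S) (hTS : T₀ * S = S) :
    (∀ t : ℝ, 0 ≤ t → expFrom T₀ (t • S) ∈ C) ↔
      (∀ v ∈ dualCone C, pairing v T₀ = 0 → 0 ≤ pairing v S) := by
  have h1 : FiniteDimensional ℂ (Lin n) := inferInstance
  have : FiniteDimensional ℝ (Lin n) := FiniteDimensional.trans ℝ ℂ (Lin n)
  -- The operator norm on `Lin n` induces the topology in which the series of `expFrom` is summed.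
  have key := fun T U => @IsMulClosedCone.add_tsum_mem_iff (Lin n) _ _ _ (hermAlg n) (pairingₗ n)
    (fun _ => eq_zero_of_pairing_self_eq_zero) C hC T U
  refine Iff.trans (forall₂_congr fun t _ => ?_) (key T₀ S hT₀ hidem hST hTS)
  rw [expFrom]

end Norm

/-! ### Topology, positive semidefinite matrices and ampliations -/

theorem continuous_lin_apply {n : ℕ} (X : Mat n) : Continuous fun T : HermMap n => T.lin X :=
  (continuous_eval_const (F := Lin n) X).comp continuous_subtype_val

theorem isClosed_setOf_posSemidef (ι : Type*) [Fintype ι] :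
    IsClosed {M : Matrix ι ι ℂ | M.PosSemidef} := by
  simp only [Matrix.posSemidef_iff_dotProduct_mulVec, Matrix.IsHermitian, Set.ofPred_and,
    Set.ofPred_forall]
  refine (isClosed_eq (by fun_prop) continuous_id).inter (isClosed_iInter fun x => ?_)
  exact isClosed_le continuous_const
    (continuous_const.dotProduct (continuous_id.matrix_mulVec continuous_const))

theorem ampliation_apply {n k : ℕ} (S : Mat n →ₗ[ℂ] Mat n)
    (X : Matrix (Fin k × Fin n) (Fin k × Fin n) ℂ) (p q : Fin k × Fin n) :
    ampliation k S X p q = S (Matrix.of fun a b => X (p.1, a) (q.1, b)) p.2 q.2 := rfl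

theorem continuous_ampliation_apply {n k : ℕ} (X : Matrix (Fin k × Fin n) (Fin k × Fin n) ℂ) :
    Continuous fun T : HermMap n => ampliation k T.lin X :=
  continuous_pi fun p => continuous_pi fun q =>
    (continuous_apply_apply p.2 q.2).comp (continuous_lin_apply _)

theorem posSemidef_real_smul {ι : Type*} [Fintype ι] {M : Matrix ι ι ℂ} (hM : M.PosSemidef)
    {r : ℝ} (hr : 0 ≤ r) : (r • M).PosSemidef :=
  hM.smul hr

/-! ### `k`-positive maps -/

theorem isMulClosedCone_coneP (n k : ℕ) : IsMulClosedCone (coneP n k) where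
  isClosed := by
    simp only [coneP, IsKPositive, Set.ofPred_forall]
    exact isClosed_iInter fun X => isClosed_iInter fun _ =>
      (isClosed_setOf_posSemidef _).preimage (continuous_ampliation_apply X)
  add_mem hS hT X hX := (hS X hX).add (hT X hX)
  smul_mem hr hS X hX := posSemidef_real_smul (hS X hX) hr
  mul_mem hS hT X hX := hS _ (hT X hX)

/-! ### Separable matrices and `k`-entanglement breaking maps -/

theorem convex_separable (k n : ℕ) : Convex ℝ (separable k n) :=
  (convex_convexHull ℝ _).closure

theorem separable_subset_posSemidef (k n : ℕ) :
    separable k n ⊆ {M | M.PosSemidef} := by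
  refine closure_minimal (convexHull_min ?_ ?_) (isClosed_setOf_posSemidef _)
  · rintro _ ⟨A, B, hA, hB, rfl⟩
    exact hA.kronecker hB
  · intro X hX Y hY a b ha hb _
    exact (posSemidef_real_smul hX ha).add (posSemidef_real_smul hY hb)

/-- Separability is preserved by linear maps that send products to products. -/
theorem map_mem_separable {k n : ℕ}
    (f : Matrix (Fin k × Fin n) (Fin k × Fin n) ℂ →ₗ[ℝ] Matrix (Fin k × Fin n) (Fin k × Fin n) ℂ)
    (hf : ∀ (A : Mat k) (B : Mat n), A.PosSemidef → B.PosSemidef →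
      ∃ (A' : Mat k) (B' : Mat n), A'.PosSemidef ∧ B'.PosSemidef ∧ f (A ⊗ₖ B) = A' ⊗ₖ B')
    {X : Matrix (Fin k × Fin n) (Fin k × Fin n) ℂ} (hX : X ∈ separable k n) :
    f X ∈ separable k n := by
  refine map_mem_closure (f := f) (LinearMap.continuous_of_finiteDimensional f) hX ?_
  intro Y hY
  have := Set.mem_image_of_mem f hY
  rw [f.image_convexHull] at this
  refine convexHull_mono ?_ this
  rintro _ ⟨_, ⟨A, B, hA, hB, rfl⟩, rfl⟩
  exact hf A B hA hB

theorem smul_mem_separable {k n : ℕ} {X : Matrix (Fin k × Fin n) (Fin k × Fin n) ℂ}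
    (hX : X ∈ separable k n) {r : ℝ} (hr : 0 ≤ r) : r • X ∈ separable k n := by
  refine map_mem_separable (r • LinearMap.id) (fun A B hA hB => ?_) hX
  exact ⟨r • A, B, posSemidef_real_smul hA hr, hB, (Matrix.smul_kronecker r A B).symm⟩

theorem add_mem_separable {k n : ℕ} {X Y : Matrix (Fin k × Fin n) (Fin k × Fin n) ℂ}
    (hX : X ∈ separable k n) (hY : Y ∈ separable k n) : X + Y ∈ separable k n := by
  have h := smul_mem_separable (convex_separable k n hX hY (a := 1 / 2) (b := 1 / 2)
    (by norm_num) (by norm_num) (by norm_num)) (r := 2) (by norm_num)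
  rwa [← smul_add, smul_smul, mul_one_div_cancel two_ne_zero, one_smul] at h

theorem isMulClosedCone_coneEB (n k : ℕ) : IsMulClosedCone (coneEB n k) where
  isClosed := by
    have h : IsClosed {S : HermMap n | ∀ X : Matrix (Fin k × Fin n) (Fin k × Fin n) ℂ,
        X.PosSemidef → ampliation k S.lin X ∈ separable k n} := by
      simp only [Set.ofPred_forall]
      exact isClosed_iInter fun X => isClosed_iInter fun _ =>
        isClosed_closure.preimage (continuous_ampliation_apply X)
    exact (isMulClosedCone_coneP n k).isClosed.inter h
  add_mem hS hT := ⟨(isMulClosedCone_coneP n k).add_mem hS.1 hT.1,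
    fun X hX => add_mem_separable (hS.2 X hX) (hT.2 X hX)⟩
  smul_mem hr hS := ⟨(isMulClosedCone_coneP n k).smul_mem hr hS.1,
    fun X hX => smul_mem_separable (hS.2 X hX) hr⟩
  mul_mem hS hT := ⟨(isMulClosedCone_coneP n k).mul_mem hS.1 hT.1,
    fun X hX => hS.2 _ (hT.1 X hX)⟩

/-! ### The dual cone of the `k`-entanglement breaking maps -/

/-- The Hilbert-Schmidt adjoint of a hermiticity preserving map. -/
def HermMap.adj {n : ℕ} (R : HermMap n) : HermMap n :=
  HermMap.ofLin (hsAdjoint R.lin) fun X => by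
    ext i j
    simp only [hsAdjoint, LinearMap.coe_mk, AddHom.coe_mk, Matrix.of_apply,
      Matrix.conjTranspose_apply, ← R.lin_conjTranspose]
    rw [← Matrix.trace_conjTranspose, Matrix.conjTranspose_mul, ← R.lin_conjTranspose,
      Matrix.trace_mul_comm]
    simp

theorem pairing_mul_right {n : ℕ} (x v w : HermMap n) :
    pairing x (v * w) = pairing (v.adj * x) w := by
  simp only [pairing_eq_sum, HermMap.lin_mul, LinearMap.comp_apply, HermMap.adj,
    HermMap.lin_ofLin, trace_hsAdjoint]

/-- The functional `X ↦ ⟨a, X a⟩`. -/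
def vectorFunctional {n : ℕ} (a : Fin n → ℂ) : Mat n →ₗ[ℂ] ℂ where
  toFun X := star a ⬝ᵥ X.mulVec a
  map_add' X Y := by rw [Matrix.add_mulVec, dotProduct_add]
  map_smul' c X := by rw [Matrix.smul_mulVec, dotProduct_smul, RingHom.id_apply]

/-- The measure-and-prepare map `X ↦ ⟨a, X a⟩ B`. -/
def measurePrepare {n : ℕ} (a : Fin n → ℂ) (B : Mat n) (hB : B.PosSemidef) : HermMap n :=
  HermMap.ofLin ((vectorFunctional a).smulRight B)
    fun X => by
      simp only [vectorFunctional, LinearMap.smulRight_apply, LinearMap.coe_mk, AddHom.coe_mk,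
        Matrix.conjTranspose_smul, hB.1.eq]
      rw [Matrix.star_dotProduct, Matrix.star_mulVec, Matrix.dotProduct_mulVec,
        Matrix.conjTranspose_conjTranspose]

theorem measurePrepare_mem_coneEB {n : ℕ} (k : ℕ) (a : Fin n → ℂ) {B : Mat n}
    (hB : B.PosSemidef) : measurePrepare a B hB ∈ coneEB n k := by
  have key : ∀ X : Matrix (Fin k × Fin n) (Fin k × Fin n) ℂ, X.PosSemidef →
      ∃ A : Mat k, A.PosSemidef ∧ ampliation k (measurePrepare a B hB).lin X = A ⊗ₖ B := by
    intro X hX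
    -- Compression of `X` by `1 ⊗ a`.
    let W : Matrix (Fin k × Fin n) (Fin k) ℂ := Matrix.of fun p q => if p.1 = q then a p.2 else 0
    refine ⟨W.conjTranspose * X * W, hX.conjTranspose_mul_mul_same W, ?_⟩
    ext p q
    rw [ampliation_apply, Matrix.kroneckerMap_apply]
    change (star a ⬝ᵥ Matrix.mulVec _ a) * B p.2 q.2 = _
    congr 1
    rw [Matrix.mul_assoc]
    simp [W, Matrix.mul_apply, dotProduct, Matrix.mulVec, Fintype.sum_prod_type, apply_ite]
  refine ⟨fun X hX => ?_, fun X hX => ?_⟩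
  · obtain ⟨A, hA, h⟩ := key X hX
    rw [h]
    exact hA.kronecker hB
  · obtain ⟨A, hA, h⟩ := key X hX
    rw [h]
    exact subset_closure (subset_convexHull ℝ _ ⟨A, B, hA, hB, rfl⟩)

theorem hsInner_measurePrepare {n : ℕ} (v : HermMap n) (a : Fin n → ℂ) {B : Mat n}
    (hB : B.PosSemidef) :
    hsInner v.lin (measurePrepare a B hB).lin = star a ⬝ᵥ (v.adj.lin B).mulVec a := by
  have h : hsAdjoint v.lin ∘ₗ (measurePrepare a B hB).lin =
      (vectorFunctional a).smulRight (v.adj.lin B) :=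
    LinearMap.ext fun X => map_smul (hsAdjoint v.lin) (vectorFunctional a X) B
  rw [hsInner, h, LinearMap.trace_smulRight]
  rfl

/-- Maps in the dual cone of `EB_k` have positive adjoints: this is the pairing with
measure-and-prepare maps. -/
theorem adj_posSemidef_of_mem_dualCone {n k : ℕ} {v : HermMap n} (hv : v ∈ dualCone (coneEB n k))
    {B : Mat n} (hB : B.PosSemidef) : (v.adj.lin B).PosSemidef := by
  refine Matrix.PosSemidef.of_dotProduct_mulVec_nonneg ?_ fun a => ?_
  · rw [Matrix.IsHermitian, ← HermMap.lin_conjTranspose, hB.1.eq]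
  · rw [← hsInner_measurePrepare v a hB, Complex.nonneg_iff]
    exact ⟨hv _ (measurePrepare_mem_coneEB k a hB), (hsInner_im _ _).symm⟩

theorem mul_mem_coneEB_of_positive {n k : ℕ} {T S : HermMap n}
    (hT : ∀ B : Mat n, B.PosSemidef → (T.lin B).PosSemidef) (hS : S ∈ coneEB n k) :
    T * S ∈ coneEB n k := by
  have hsep : ∀ X : Matrix (Fin k × Fin n) (Fin k × Fin n) ℂ, X.PosSemidef →
      ampliation k (T * S).lin X ∈ separable k n := fun X hX =>
    map_mem_separable ((ampliation k T.lin).restrictScalars ℝ)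
      (fun A B hA hB => ⟨A, T.lin B, hA, hT B hB, ampliation_kronecker k T.lin A B⟩) (hS.2 X hX)
  exact ⟨fun X hX => separable_subset_posSemidef k n (hsep X hX), hsep⟩

theorem isMulClosedCone_dualCone_coneEB (n k : ℕ) :
    IsMulClosedCone (dualCone (coneEB n k)) where
  isClosed := by
    simp only [dualCone, Set.ofPred_forall]
    refine isClosed_iInter fun x => isClosed_iInter fun _ => isClosed_le continuous_const ?_
    simp only [pairing_eq_sum]
    have := @continuous_lin_apply n
    fun_prop
  add_mem {v w} hv hw x hx := by
    rw [show pairing (v + w) x = pairing v x + pairing w x from (pairingₗ n).map_add₂ v w x]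
    exact add_nonneg (hv x hx) (hw x hx)
  smul_mem {r v} hr hv x hx := by
    rw [show pairing (r • v) x = r * pairing v x from (pairingₗ n).map_smul₂ r v x]
    exact mul_nonneg hr (hv x hx)
  mul_mem {v w} hv hw x hx := by
    rw [pairing_comm, pairing_mul_right, pairing_comm]
    exact hw _ (mul_mem_coneEB_of_positive (fun B => adj_posSemidef_of_mem_dualCone hv) hx)

/-! ### `k`-superpositive maps -/

/-- The map `X ↦ L* X L`. -/
def conjBy {n : ℕ} (L : Mat n) : HermMap n :=
  HermMap.ofLin (LinearMap.mulRight ℂ L ∘ₗ LinearMap.mulLeft ℂ L.conjTranspose) fun X => by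
    simp [Matrix.mul_assoc]

theorem conjBy_lin_apply {n : ℕ} (L X : Mat n) :
    (conjBy L).lin X = L.conjTranspose * X * L := rfl

theorem conjBy_mul_conjBy {n : ℕ} (L M : Mat n) : conjBy L * conjBy M = conjBy (M * L) :=
  HermMap.ext_lin fun X => by
    simp [conjBy_lin_apply, Matrix.mul_assoc]

theorem conjBy_smul {n : ℕ} (r : ℝ) (L : Mat n) : conjBy (r • L) = (r ^ 2) • conjBy L :=
  HermMap.ext_lin fun X => by
    simp [conjBy_lin_apply, HermMap.lin_smul_apply, smul_smul, sq]

section Norm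

open scoped Matrix.Norms.L2Operator

theorem continuous_conjBy (n : ℕ) : Continuous (conjBy : Mat n → HermMap n) := by
  refine Continuous.subtype_mk (continuous_clm_apply.2 fun X => ?_) _
  change Continuous fun L : Mat n => L.conjTranspose * X * L
  fun_prop

end Norm

theorem HermMap.lin_sum {n : ℕ} {ι : Type*} (s : Finset ι) (f : ι → HermMap n) (X : Mat n) :
    (∑ i ∈ s, f i).lin X = ∑ i ∈ s, (f i).lin X := by
  classical
  induction s using Finset.induction_on with
  | empty => rfl
  | insert a s ha ih => rw [Finset.sum_insert ha, Finset.sum_insert ha, ← ih]; rfl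

theorem mem_coneS_iff {n k : ℕ} {S : HermMap n} :
    S ∈ coneS n k ↔ ∃ (p : ℕ) (L : Fin p → Mat n), (∀ i, (L i).rank ≤ k) ∧
      S = ∑ i, conjBy (L i) := by
  refine exists₂_congr fun p L => and_congr_right fun _ => ⟨fun h => ?_, ?_⟩
  · exact HermMap.ext_lin fun X => by rw [h, HermMap.lin_sum]; rfl
  · rintro rfl X
    rw [HermMap.lin_sum]
    rfl

theorem conjBy_mem_coneS {n k : ℕ} {L : Mat n} (hL : L.rank ≤ k) : conjBy L ∈ coneS n k :=
  mem_coneS_iff.2 ⟨1, fun _ => L, fun _ => hL, by simp⟩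

theorem add_mem_coneS {n k : ℕ} {S T : HermMap n} (hS : S ∈ coneS n k) (hT : T ∈ coneS n k) :
    S + T ∈ coneS n k := by
  obtain ⟨p, L, hL, rfl⟩ := mem_coneS_iff.1 hS
  obtain ⟨q, M, hM, rfl⟩ := mem_coneS_iff.1 hT
  refine mem_coneS_iff.2 ⟨p + q, Fin.append L M, fun i => ?_, ?_⟩
  · refine Fin.addCases (fun i => ?_) (fun i => ?_) i
    · simpa using hL i
    · simpa using hM i
  · simp [Fin.sum_univ_add]

theorem sum_mem_coneS {n k : ℕ} {ι : Type*} (s : Finset ι) {f : ι → HermMap n}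
    (hf : ∀ i ∈ s, f i ∈ coneS n k) : ∑ i ∈ s, f i ∈ coneS n k :=
  Finset.sum_induction _ (· ∈ coneS n k) (fun _ _ => add_mem_coneS)
    (mem_coneS_iff.2 ⟨0, Fin.elim0, fun i => i.elim0, by simp⟩) hf

theorem rank_real_smul_le {n : ℕ} (r : ℝ) (L : Mat n) : (r • L).rank ≤ L.rank := by
  have : r • L = L * (r • (1 : Mat n)) := by simp
  rw [this]
  exact Matrix.rank_mul_le_left _ _

theorem smul_mem_coneS {n k : ℕ} {r : ℝ} {S : HermMap n} (hr : 0 ≤ r) (hS : S ∈ coneS n k) :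
    r • S ∈ coneS n k := by
  obtain ⟨p, L, hL, rfl⟩ := mem_coneS_iff.1 hS
  rw [Finset.smul_sum]
  refine sum_mem_coneS _ fun i _ => ?_
  have : r • conjBy (L i) = conjBy (√r • L i) := by rw [conjBy_smul, Real.sq_sqrt hr]
  rw [this]
  exact conjBy_mem_coneS ((rank_real_smul_le _ _).trans (hL i))

theorem mul_mem_coneS {n k : ℕ} {S T : HermMap n} (hS : S ∈ coneS n k) (hT : T ∈ coneS n k) :
    S * T ∈ coneS n k := by
  obtain ⟨p, L, hL, rfl⟩ := mem_coneS_iff.1 hS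
  obtain ⟨q, M, hM, rfl⟩ := mem_coneS_iff.1 hT
  rw [Finset.sum_mul_sum]
  refine sum_mem_coneS _ fun i _ => sum_mem_coneS _ fun j _ => ?_
  rw [conjBy_mul_conjBy]
  exact conjBy_mem_coneS ((Matrix.rank_mul_le_right _ _).trans (hL i))

/-- The real functional `T ↦ Re Tr (T 1)`, which is the squared Frobenius norm of `L` at
`X ↦ L* X L`. -/
def traceOne (n : ℕ) : HermMap n →ₗ[ℝ] ℝ where
  toFun T := (T.lin 1).trace.re
  map_add' S T := by simp
  map_smul' r T := by simp [HermMap.lin_smul_apply]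

theorem continuous_traceOne (n : ℕ) : Continuous (traceOne n) :=
  Complex.continuous_re.comp (continuous_lin_apply 1).matrix_trace

theorem traceOne_conjBy {n : ℕ} (L : Mat n) : traceOne n (conjBy L) = ∑ i, ∑ j, ‖L i j‖ ^ 2 := by
  change ((conjBy L).lin 1).trace.re = _
  rw [conjBy_lin_apply, mul_one, Finset.sum_comm]
  simp [Matrix.trace, Matrix.mul_apply, ← Complex.normSq_eq_norm_sq, Complex.normSq_apply]

/-- The extremal generators of `S_k`, normalized by `traceOne = 1`. -/
def generatorsS (n k : ℕ) : Set (HermMap n) :=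
  conjBy '' {L : Mat n | L.rank ≤ k ∧ traceOne n (conjBy L) = 1}

theorem isCompact_generatorsS (n k : ℕ) : IsCompact (generatorsS n k) := by
  refine IsCompact.image ?_ (continuous_conjBy n)
  have hbox : IsCompact (Set.univ.pi fun _ : Fin n => Set.univ.pi fun _ : Fin n =>
      Metric.closedBall (0 : ℂ) 1) :=
    isCompact_univ_pi fun _ => isCompact_univ_pi fun _ => isCompact_closedBall 0 1
  refine hbox.of_isClosed_subset ((Matrix.isClosed_setOf_rank_le n k).inter
    (isClosed_eq ((continuous_traceOne n).comp (continuous_conjBy n)) continuous_const)) ?_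
  rintro (L : Mat n) ⟨-, hL : traceOne n (conjBy L) = 1⟩ i - j -
  rw [mem_closedBall_zero_iff, ← sq_le_one_iff₀ (norm_nonneg _), ← hL, traceOne_conjBy]
  exact (Finset.single_le_sum (f := fun j => ‖L i j‖ ^ 2) (fun _ _ => by positivity)
    (Finset.mem_univ j)).trans (Finset.single_le_sum (f := fun i => ∑ j, ‖L i j‖ ^ 2)
      (fun _ _ => by positivity) (Finset.mem_univ i))

theorem conjBy_mem_cone_generatorsS {n k : ℕ} {L : Mat n} (hL : L.rank ≤ k) (h0 : L ≠ 0) :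
    ∃ r : ℝ, 0 < r ∧ ∃ y ∈ generatorsS n k, conjBy L = r • y := by
  have hpos : 0 < traceOne n (conjBy L) := by
    rw [traceOne_conjBy]
    refine lt_of_le_of_ne (by positivity) fun h => h0 ?_
    ext i j
    have h1 := (Finset.sum_eq_zero_iff_of_nonneg (fun _ _ => by positivity)).1 h.symm i
      (Finset.mem_univ i)
    have h2 := (Finset.sum_eq_zero_iff_of_nonneg (fun _ _ => by positivity)).1 h1 j
      (Finset.mem_univ j)
    simpa using h2
  set r := traceOne n (conjBy L) with hr
  have hs : conjBy ((√r)⁻¹ • L) = r⁻¹ • conjBy L := by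
    rw [conjBy_smul, inv_pow, Real.sq_sqrt hpos.le]
  refine ⟨r, hpos, _, ⟨(√r)⁻¹ • L, ⟨(rank_real_smul_le _ _).trans hL, ?_⟩, rfl⟩, ?_⟩
  · rw [hs, map_smul, ← hr, smul_eq_mul, inv_mul_cancel₀ hpos.ne']
  · rw [hs, smul_inv_smul₀ hpos.ne']

/-- The cone `S_k` is generated by the convex hull of `generatorsS`. The apex is listed
separately, as there are no generators when `n = 0` or `k = 0`. -/
theorem coneS_eq_insert_cone {n k : ℕ} : coneS n k =
    insert 0 {x | ∃ r : ℝ, 0 ≤ r ∧ ∃ y ∈ convexHull ℝ (generatorsS n k), x = r • y} := by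
  have hzero : (0 : HermMap n) ∈ coneS n k := by
    simpa using sum_mem_coneS (k := k) (∅ : Finset ℕ) (f := fun _ => (0 : HermMap n)) (by simp)
  have hconv : Convex ℝ (coneS n k) := fun x hx y hy a b ha hb _ =>
    add_mem_coneS (smul_mem_coneS ha hx) (smul_mem_coneS hb hy)
  refine Set.Subset.antisymm (fun S hS => ?_) ?_
  · obtain ⟨p, L, hL, rfl⟩ := mem_coneS_iff.1 hS
    refine Finset.sum_induction _ (· ∈ insert (0 : HermMap n) _) ?_ (Set.mem_insert _ _)
      fun i _ => ?_
    · rintro x y (rfl | ⟨r, hr, x, hx, rfl⟩) (rfl | ⟨s, hs, y, hy, rfl⟩)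
      · rw [add_zero]
        exact Set.mem_insert _ _
      · rw [zero_add]
        exact Or.inr ⟨s, hs, y, hy, rfl⟩
      · rw [add_zero]
        exact Or.inr ⟨r, hr, x, hx, rfl⟩
      · rcases (add_nonneg hr hs).eq_or_lt with h | h
        · have hr0 : r = 0 := by linarith
          have hs0 : s = 0 := by linarith
          left
          rw [hr0, hs0, zero_smul, zero_smul, add_zero]
        · refine Or.inr ⟨r + s, h.le, _, convex_convexHull ℝ _ hx hy
            (div_nonneg hr h.le) (div_nonneg hs h.le) (by field_simp), ?_⟩
          rw [smul_add, smul_smul, smul_smul, mul_div_cancel₀ _ h.ne', mul_div_cancel₀ _ h.ne']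
    · rcases eq_or_ne (L i) 0 with h | h
      · left
        rw [h]
        exact HermMap.ext_lin fun X => by
          rw [conjBy_lin_apply, mul_zero]
          rfl
      · obtain ⟨r, hr, y, hy, h⟩ := conjBy_mem_cone_generatorsS (hL i) h
        exact Or.inr ⟨r, hr.le, y, subset_convexHull ℝ _ hy, h⟩
  · rintro _ (rfl | ⟨r, hr, y, hy, rfl⟩)
    · exact hzero
    · refine smul_mem_coneS hr (convexHull_min ?_ hconv hy)
      rintro _ ⟨L, hL, rfl⟩
      exact conjBy_mem_coneS hL.1

instance instFiniteDimensionalHermMap (n : ℕ) : FiniteDimensional ℝ (HermMap n) := by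
  have h1 : FiniteDimensional ℂ (Lin n) := inferInstance
  have : FiniteDimensional ℝ (Lin n) := FiniteDimensional.trans ℝ ℂ (Lin n)
  infer_instance

instance instContinuousAddHermMap (n : ℕ) : ContinuousAdd (HermMap n) :=
  ⟨((continuous_subtype_val.comp continuous_fst).add
    (continuous_subtype_val.comp continuous_snd)).subtype_mk _⟩

instance instContinuousSMulHermMap (n : ℕ) : ContinuousSMul ℝ (HermMap n) :=
  have : ContinuousSMul ℝ (Lin n) := IsScalarTower.continuousSMul ℂ
  ⟨(continuous_fst.smul (continuous_subtype_val.comp continuous_snd)).subtype_mk _⟩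

theorem isMulClosedCone_coneS (n k : ℕ) : IsMulClosedCone (coneS n k) where
  isClosed := by
    rw [coneS_eq_insert_cone]
    refine isClosed_singleton.union ?_
    refine (isCompact_generatorsS n k).convexHull_of_finiteDimensional.isClosed_cone
      (continuous_traceOne n) fun x hx => ?_
    refine convexHull_min (t := {x | traceOne n x = 1}) ?_ ?_ hx
    · rintro _ ⟨L, hL, rfl⟩
      exact hL.2
    · exact (convex_singleton (1 : ℝ)).linear_preimage (traceOne n)
  add_mem := add_mem_coneS
  smul_mem := smul_mem_coneS
  mul_mem := mul_mem_coneS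

end QCone

end

theorem theorem4p3 (n k : ℕ) (hk : 1 ≤ k) (hkn : k ≤ n)
    (C : Set (QCone.HermMap n))
    (hC : C = QCone.coneP n k ∨ C = QCone.coneS n k ∨ C = QCone.coneEB n k ∨
      C = QCone.dualCone (QCone.coneEB n k))
    (T₀ : QCone.HermMap n) (hT₀ : T₀ ∈ C) (hidem : IsIdempotentElem T₀)
    (S : QCone.HermMap n) (hST : S * T₀ = S) (hTS : T₀ * S = S) :
    (∀ t : ℝ, 0 ≤ t → QCone.expFrom T₀ (t • S) ∈ C) ↔
      (∀ v ∈ QCone.dualCone C, QCone.pairing v T₀ = 0 → 0 ≤ QCone.pairing v S) := by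
  have hcone : IsMulClosedCone C := by
    rcases hC with rfl | rfl | rfl | rfl
    · exact QCone.isMulClosedCone_coneP n k
    · exact QCone.isMulClosedCone_coneS n k
    · exact QCone.isMulClosedCone_coneEB n k
    · exact QCone.isMulClosedCone_dualCone_coneEB n k
  exact QCone.expFrom_mem_iff hcone hT₀ hidem hST hTS
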